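/- Let $K$ be a field, $A$ a $K$-algebra and $P$ a finite partially ordered set with greatest element $m$. Let $\mathcal R=\{\mathcal R_{i,j}\}_{i\le j}$ be a family of finite-dimensional $K$-subspaces of $A$, indexed by the pairs $i\le j$ in $P$, such that $\mathcal R_{i,j}\mathcal R_{j,l}\subseteq \mathcal R_{i,l}$ for $i\le j\le l$, and such that each $\mathcal R_i=\mathcal R_{i,i}$ is a $K$-algebra with a unit $1_i$ (possibly different from $1_A$) satisfying $1_i r=r=r1_j$ for all $r\in\mathcal R_{i,j}$, $i\le j$. Assume that $\mathcal R$ is admissible: every $\mathcal R_i$ is a division ring, and whenever $i\le j<m$ and $0\ne x\in\mathcal R_{i,j}$, there are $l\ge j$ with $l\neq j$ and $y\in\mathcal R_{j,l}$ with $xy\ne0$. Let $\Lambda=\Lambda(\mathcal R)=\bigoplus_{i\le j}e_{i,j}\mathcal R_{i,j}$ with matrix multiplication, where $e_{i,j}$ are the matrix units indexed by $P$, let $e_i=e_{i,i}1_i$, write $D=\operatorname{Hom}_K(-,K)$, and let $E=D(\Lambda e_m)$, an $\mathcal R_m$-$\Lambda$-bimodule via $(rf)(x)=f(xr)$ and $(fa)(x)=f(ax)$.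 Put $$\widetilde\Lambda=\begin{pmatrix}\mathcal R_m&E\\0&\Lambda\end{pmatrix},\qquad e_0=\begin{pmatrix}1_m&0\\0&0\end{pmatrix}\in\widetilde\Lambda,$$ and write $e_m\in\widetilde\Lambda$ also for $\begin{pmatrix}0&0\\0&e_m\end{pmatrix}$. A ring $B$ is called right (left) peak if the socle of the right (left) module $B$ is isomorphic to a direct sum of finitely many copies of a simple projective right (left) module, and $1$-Gorenstein if the injective envelope of the right module $B$ is projective. Then: 1. As a right $\Lambda$-module, $E$ is an injective envelope of $e_m\Lambda$. 2. $\widetilde\Lambda$ is both right peak and left peak. 3. $D(\widetilde\Lambda e_m)\cong e_0\widetilde\Lambda$ as right $\widetilde\Lambda$-modules, this module is projective, and $\widetilde\Lambda$ is $1$-Gorenstein. 4. If $P$ also has a least element $0$, if $\mathcal R_{0,0}=\mathcal R_{m,m}$ as subspaces of $A$, and if for every $i\in P$ there is an isomorphism $\mathcal R_{0,i}\cong D(\mathcal R_{i,m})$ (of $K$-vector spaces suffices), then $\Lambda(\mathcal R)$ is $1$-Gorenstein. -/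

import Mathlib

noncomputable section

namespace PeakAlg

/-! ## Modules: socle, injective envelope, peak algebras, 1-Gorenstein algebras

Right modules over a ring `B` are modules over `Bᵐᵒᵖ`; in particular `B` itself carries its right
regular module structure as a `Bᵐᵒᵖ`-module. -/

/-- The socle of a module: the sum of all its simple submodules. -/
def socle (R : Type*) [Ring R] (M : Type*) [AddCommGroup M] [Module R M] : Submodule R M :=
  sSup {N : Submodule R M | IsSimpleModule R N}

/-- `Q` is an injective envelope of `M`: an injective module that is an essential extension
of (an isomorphic copy of) `M`. -/
def IsInjectiveEnvelope (R : Type*) [Ring R] (M : Type*) [AddCommGroup M] [Module R M]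
    (Q : Type*) [AddCommGroup Q] [Module R Q] : Prop :=
  Module.Injective R Q ∧
    ∃ f : M →ₗ[R] Q, Function.Injective f ∧
      ∀ N : Submodule R Q, N ≠ ⊥ → N ⊓ LinearMap.range f ≠ ⊥

/-- The socle of `M` is a direct sum of finitely many copies of a simple projective module. -/
def HasPeakSocle.{u} (R : Type u) [Ring R] (M : Type u) [AddCommGroup M] [Module R M] : Prop :=
  ∃ (T : Type u) (_ : AddCommGroup T) (_ : Module R T),
    IsSimpleModule R T ∧ Module.Projective R T ∧
      ∃ n : ℕ, Nonempty (socle R M ≃ₗ[R] (Fin n → T))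

/-- Right peak: the socle of the right regular module is a finite direct sum of copies of a
simple projective right module. -/
def IsRightPeak.{u} (B : Type u) [Ring B] : Prop := HasPeakSocle.{u} Bᵐᵒᵖ B

/-- Left peak: the socle of the left regular module is a finite direct sum of copies of a
simple projective left module. -/
def IsLeftPeak.{u} (B : Type u) [Ring B] : Prop := HasPeakSocle.{u} B B

/-- 1-Gorenstein: the injective envelope of the right regular module is projective. -/
def IsOneGorenstein.{u} (B : Type u) [Ring B] : Prop :=
  ∃ (Q : Type u) (_ : AddCommGroup Q) (_ : Module Bᵐᵒᵖ Q),
    IsInjectiveEnvelope Bᵐᵒᵖ B Q ∧ Module.Projective Bᵐᵒᵖ Q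

/-- The right ideal `e B`, a right `B`-module. -/
abbrev rightIdeal {B : Type*} [Ring B] (e : B) : Submodule Bᵐᵒᵖ B := Submodule.span Bᵐᵒᵖ {e}

/-- The left ideal `B e`, a left `B`-module. -/
abbrev leftIdeal {B : Type*} [Ring B] (e : B) : Submodule B B := Submodule.span B {e}

section Duality

/-- The `K`-dual `D(N)` of a left `B`-module `N`. It is a type synonym of `N →ₗ[K] K` that carries
the right `B`-module structure `(f b)(x) = f (b x)`. -/
def D (K : Type*) [Field K] (N : Type*) [AddCommGroup N] [Module K N] : Type _ := N →ₗ[K] K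

variable {K : Type*} [Field K] {N : Type*} [AddCommGroup N] [Module K N]

instance : AddCommGroup (D K N) := inferInstanceAs (AddCommGroup (N →ₗ[K] K))

instance : Module K (D K N) := inferInstanceAs (Module K (N →ₗ[K] K))

instance : FunLike (D K N) N K := inferInstanceAs (FunLike (N →ₗ[K] K) N K)

instance : LinearMapClass (D K N) K N K := inferInstanceAs (LinearMapClass (N →ₗ[K] K) K N K)

@[ext] theorem D.ext {f g : D K N} (h : ∀ x, f x = g x) : f = g := LinearMap.ext h

theorem D.add_apply (f g : D K N) (x : N) : (f + g) x = f x + g x := rfl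

theorem D.zero_apply (x : N) : (0 : D K N) x = 0 := rfl

theorem D.smul_apply (c : K) (f : D K N) (x : N) : (c • f) x = c * f x := rfl

variable {B : Type*} [Ring B] [Module B N] [SMulCommClass B K N]

instance : SMul Bᵐᵒᵖ (D K N) where
  smul b f := (show N →ₗ[K] K from f) ∘ₗ DistribSMul.toLinearMap K N b.unop

theorem D.op_smul_apply (b : Bᵐᵒᵖ) (f : D K N) (x : N) : (b • f) x = f (b.unop • x) := rfl

instance : Module Bᵐᵒᵖ (D K N) where
  one_smul f := by ext x; simp [D.op_smul_apply]
  mul_smul a b f := by ext x; simp [D.op_smul_apply, mul_smul]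
  smul_zero a := by ext x; simp [D.op_smul_apply, D.zero_apply]
  smul_add a f g := by ext x; simp [D.op_smul_apply, D.add_apply]
  add_smul a b f := by ext x; simp [D.op_smul_apply, D.add_apply, add_smul]
  zero_smul f := by ext x; simp [D.op_smul_apply, D.zero_apply]

end Duality

/-! ## Triangular matrix algebras -/

/-- The set of triangular matrices `[[r, x], [0, a]]` with `r ∈ R`, `x ∈ M`, `a ∈ L`. -/
@[ext] structure TriMat (R M L : Type*) where
  /-- upper left entry -/
  r : R
  /-- upper right entry -/
  x : M
  /-- lower right entry -/
  a : L

namespace TriMat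

variable {R M L : Type*} [Ring R] [AddCommGroup M] [Ring L]

instance : Zero (TriMat R M L) := ⟨⟨0, 0, 0⟩⟩
instance : One (TriMat R M L) := ⟨⟨1, 0, 1⟩⟩
instance : Add (TriMat R M L) := ⟨fun s t => ⟨s.r + t.r, s.x + t.x, s.a + t.a⟩⟩
instance : Neg (TriMat R M L) := ⟨fun s => ⟨-s.r, -s.x, -s.a⟩⟩

@[simp] theorem zero_r : (0 : TriMat R M L).r = 0 := rfl
@[simp] theorem zero_x : (0 : TriMat R M L).x = 0 := rfl
@[simp] theorem zero_a : (0 : TriMat R M L).a = 0 := rfl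
@[simp] theorem one_r : (1 : TriMat R M L).r = 1 := rfl
@[simp] theorem one_x : (1 : TriMat R M L).x = 0 := rfl
@[simp] theorem one_a : (1 : TriMat R M L).a = 1 := rfl
@[simp] theorem add_r (s t : TriMat R M L) : (s + t).r = s.r + t.r := rfl
@[simp] theorem add_x (s t : TriMat R M L) : (s + t).x = s.x + t.x := rfl
@[simp] theorem add_a (s t : TriMat R M L) : (s + t).a = s.a + t.a := rfl
@[simp] theorem neg_r (s : TriMat R M L) : (-s).r = -s.r := rfl
@[simp] theorem neg_x (s : TriMat R M L) : (-s).x = -s.x := rfl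
@[simp] theorem neg_a (s : TriMat R M L) : (-s).a = -s.a := rfl

instance : AddCommGroup (TriMat R M L) where
  add_assoc s t u := by ext <;> simp [add_assoc]
  zero_add s := by ext <;> simp
  add_zero s := by ext <;> simp
  add_comm s t := by ext <;> simp [add_comm]
  neg_add_cancel s := by ext <;> simp
  nsmul := nsmulRec
  zsmul := zsmulRec

section Ring

variable [Module R M] [Module Lᵐᵒᵖ M]

/-- Matrix multiplication; `x a` is the right action `MulOpposite.op a • x`. -/
instance : Mul (TriMat R M L) :=
  ⟨fun s t => ⟨s.r * t.r, s.r • t.x + MulOpposite.op t.a • s.x, s.a * t.a⟩⟩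

@[simp] theorem mul_r (s t : TriMat R M L) : (s * t).r = s.r * t.r := rfl
@[simp] theorem mul_x (s t : TriMat R M L) :
    (s * t).x = s.r • t.x + MulOpposite.op t.a • s.x := rfl
@[simp] theorem mul_a (s t : TriMat R M L) : (s * t).a = s.a * t.a := rfl

instance [SMulCommClass R Lᵐᵒᵖ M] : Ring (TriMat R M L) where
  __ := (inferInstance : AddCommGroup (TriMat R M L))
  left_distrib s t u := by
    ext
    · simp [mul_add]
    · simp only [mul_x, add_x, add_a, smul_add, MulOpposite.op_add, add_smul]; abel
    · simp [mul_add]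
  right_distrib s t u := by
    ext
    · simp [add_mul]
    · simp only [mul_x, add_x, add_r, smul_add, add_smul]; abel
    · simp [add_mul]
  zero_mul s := by ext <;> simp
  mul_zero s := by ext <;> simp
  mul_assoc s t u := by
    ext
    · simp [mul_assoc]
    · simp only [mul_x, mul_r, mul_a, smul_add, MulOpposite.op_mul, mul_smul, add_assoc]
      rw [smul_comm s.r (MulOpposite.op u.a) t.x]
    · simp [mul_assoc]
  one_mul s := by ext <;> simp
  mul_one s := by ext <;> simp

end Ring

section Algebra

variable {K : Type*} [Field K] [Algebra K R] [Algebra K L] [Module K M]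

instance : SMul K (TriMat R M L) := ⟨fun c s => ⟨c • s.r, c • s.x, c • s.a⟩⟩

@[simp] theorem smul_r (c : K) (s : TriMat R M L) : (c • s).r = c • s.r := rfl
@[simp] theorem smul_x (c : K) (s : TriMat R M L) : (c • s).x = c • s.x := rfl
@[simp] theorem smul_a (c : K) (s : TriMat R M L) : (c • s).a = c • s.a := rfl

instance : Module K (TriMat R M L) where
  one_smul s := by ext <;> simp
  mul_smul c d s := by ext <;> simp [mul_smul]
  smul_zero c := by ext <;> simp
  smul_add c s t := by ext <;> simp
  add_smul c d s := by ext <;> simp [add_smul]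
  zero_smul s := by ext <;> simp

/-- The `K`-algebra structure, for a bimodule on which `K` acts centrally. -/
instance [Module R M] [Module Lᵐᵒᵖ M] [SMulCommClass R Lᵐᵒᵖ M] [IsScalarTower K R M] [SMulCommClass R K M]
    [SMulCommClass Lᵐᵒᵖ K M] [IsScalarTower K Lᵐᵒᵖ M] : Algebra K (TriMat R M L) :=
  Algebra.ofModule
    (fun c s t => by
      ext
      · simp
      · simp only [mul_x, smul_r, smul_x, smul_add, smul_assoc]
        rw [smul_comm (MulOpposite.op t.a) c s.x]
      · simp)
    (fun c s t => by
      ext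
      · simp
      · simp only [mul_x, smul_a, smul_x, smul_add, MulOpposite.op_smul, smul_assoc]
        rw [smul_comm s.r c t.x]
      · simp)

end Algebra

end TriMat

/-! ## Multiplicative systems and their incidence algebras -/

/-- A `P`-multiplicative system over the `K`-algebra `A`: `K`-subspaces `R_{i,j} ⊆ A`, for
`i ≤ j`, with `R_{i,j} R_{j,l} ⊆ R_{i,l}`, such that every `R_i = R_{i,i}` is an algebra with a
unit `1_i` (not necessarily the unit of `A`) which acts as a left unit on every `R_{i,j}` and as
a right unit on every `R_{j,i}`. -/
structure MultSystem (K A P : Type*) [Field K] [Ring A] [Algebra K A] [PartialOrder P] where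
  /-- the subspaces `R_{i,j}` -/
  R : ∀ {i j : P}, i ≤ j → Submodule K A
  /-- the units `1_i` -/
  unit : P → A
  mul_mem : ∀ {i j l : P} (hij : i ≤ j) (hjl : j ≤ l) {x y : A},
    x ∈ R hij → y ∈ R hjl → x * y ∈ R (hij.trans hjl)
  unit_mem : ∀ i : P, unit i ∈ R (le_refl i)
  unit_mul : ∀ {i j : P} (hij : i ≤ j) {x : A}, x ∈ R hij → unit i * x = x
  mul_unit : ∀ {i j : P} (hij : i ≤ j) {x : A}, x ∈ R hij → x * unit j = x

namespace MultSystem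

variable {K A P : Type*} [Field K] [Ring A] [Algebra K A] [PartialOrder P]
variable (S : MultSystem K A P)

/-- The algebra `R_i = R_{i,i}`. -/
def Pt (i : P) : Type _ := ↥(S.R (le_refl i))

namespace Pt

variable {S} {i : P}

instance : AddCommGroup (S.Pt i) := inferInstanceAs (AddCommGroup ↥(S.R (le_refl i)))
instance : Module K (S.Pt i) := inferInstanceAs (Module K ↥(S.R (le_refl i)))
instance : One (S.Pt i) := ⟨⟨S.unit i, S.unit_mem i⟩⟩
instance : Mul (S.Pt i) := ⟨fun x y => ⟨x.1 * y.1, S.mul_mem (le_refl i) (le_refl i) x.2 y.2⟩⟩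

theorem ext {x y : S.Pt i} (h : x.1 = y.1) : x = y := Subtype.ext h

theorem val_one : (1 : S.Pt i).1 = S.unit i := rfl
theorem val_zero : (0 : S.Pt i).1 = 0 := rfl
theorem val_add (x y : S.Pt i) : (x + y).1 = x.1 + y.1 := rfl
theorem val_neg (x : S.Pt i) : (-x).1 = -x.1 := rfl
theorem val_mul (x y : S.Pt i) : (x * y).1 = x.1 * y.1 := rfl
theorem val_smul (c : K) (x : S.Pt i) : (c • x).1 = c • x.1 := rfl

instance : Ring (S.Pt i) where
  __ := (inferInstance : AddCommGroup (S.Pt i))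
  left_distrib x y z := ext (by simp only [val_mul, val_add, mul_add])
  right_distrib x y z := ext (by simp only [val_mul, val_add, add_mul])
  zero_mul x := ext (by simp only [val_mul, val_zero, zero_mul])
  mul_zero x := ext (by simp only [val_mul, val_zero, mul_zero])
  mul_assoc x y z := ext (by simp only [val_mul, mul_assoc])
  one_mul x := ext (S.unit_mul (le_refl i) x.2)
  mul_one x := ext (S.mul_unit (le_refl i) x.2)

instance : Algebra K (S.Pt i) :=
  Algebra.ofModule (fun c x y => ext (by simp only [val_mul, val_smul, smul_mul_assoc]))
    (fun c x y => ext (by simp only [val_mul, val_smul, mul_smul_comm]))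

end Pt

/-- An admissible system, for a poset with greatest element: (1) every `R_i` is a division ring;
(2) if `j` is not the greatest element and `0 ≠ x ∈ R_{i,j}`, then `x y ≠ 0` for some
`y ∈ R_{j,l}` with `l ≠ j`. -/
structure IsAdmissible [OrderTop P] : Prop where
  nontrivial : ∀ i : P, Nontrivial (S.Pt i)
  isUnit_of_ne_zero : ∀ (i : P) (x : S.Pt i), x ≠ 0 → IsUnit x
  exists_mul_ne_zero : ∀ {i j : P} (hij : i ≤ j), j < ⊤ → ∀ x ∈ S.R hij, x ≠ 0 →
    ∃ (l : P) (hjl : j ≤ l), l ≠ j ∧ ∃ y ∈ S.R hjl, x * y ≠ 0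

variable [Fintype P]

/-- The matrices over `A`, indexed by `P`, with `(i,j)` entry in `R_{i,j}` if `i ≤ j` and zero
otherwise. They are closed under matrix multiplication. -/
def incidence : NonUnitalSubalgebra K (Matrix P P A) where
  carrier := {X | (∀ (i j : P) (h : i ≤ j), X i j ∈ S.R h) ∧ ∀ i j : P, ¬ i ≤ j → X i j = 0}
  add_mem' {X Y} hX hY :=
    ⟨fun i j h => (S.R h).add_mem (hX.1 i j h) (hY.1 i j h),
      fun i j h => by rw [Matrix.add_apply, hX.2 i j h, hY.2 i j h, add_zero]⟩
  zero_mem' := ⟨fun _ _ h => (S.R h).zero_mem, fun _ _ _ => rfl⟩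
  smul_mem' c X hX :=
    ⟨fun i j h => (S.R h).smul_mem c (hX.1 i j h),
      fun i j h => by rw [Matrix.smul_apply, hX.2 i j h, smul_zero]⟩
  mul_mem' {X Y} hX hY := by
    refine ⟨fun i l h => ?_, fun i l h => ?_⟩
    · rw [Matrix.mul_apply]
      refine Submodule.sum_mem _ fun j _ => ?_
      by_cases hij : i ≤ j
      · by_cases hjl : j ≤ l
        · exact S.mul_mem hij hjl (hX.1 i j hij) (hY.1 j l hjl)
        · rw [hY.2 j l hjl, mul_zero]; exact Submodule.zero_mem _
      · rw [hX.2 i j hij, zero_mul]; exact Submodule.zero_mem _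
    · rw [Matrix.mul_apply]
      refine Finset.sum_eq_zero fun j _ => ?_
      by_cases hij : i ≤ j
      · rw [hY.2 j l fun hjl => h (hij.trans hjl), mul_zero]
      · rw [hX.2 i j hij, zero_mul]

/-- The algebra `Λ(R)`, the direct sum of the `e_{i,j} R_{i,j}` with matrix multiplication and
with unit the diagonal matrix of the units `1_i`. -/
def Lam : Type _ := ↥S.incidence

namespace Lam

variable {S}

instance : NonUnitalRing S.Lam := inferInstanceAs (NonUnitalRing ↥S.incidence)
instance : Module K S.Lam := inferInstanceAs (Module K ↥S.incidence)

theorem ext {X Y : S.Lam} (h : X.1 = Y.1) : X = Y := Subtype.ext h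

theorem val_mul (X Y : S.Lam) : (X * Y).1 = X.1 * Y.1 := rfl
theorem val_add (X Y : S.Lam) : (X + Y).1 = X.1 + Y.1 := rfl
theorem val_zero : (0 : S.Lam).1 = 0 := rfl
theorem val_smul (c : K) (X : S.Lam) : (c • X).1 = c • X.1 := rfl

variable [DecidableEq P]

instance : One S.Lam :=
  ⟨⟨Matrix.diagonal S.unit,
    fun i j h => by
      by_cases hij : i = j
      · subst hij; rw [Matrix.diagonal_apply_eq]; exact S.unit_mem i
      · rw [Matrix.diagonal_apply_ne _ hij]; exact Submodule.zero_mem _,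
    fun i j h => Matrix.diagonal_apply_ne _ fun hij => h hij.le⟩⟩

theorem val_one : (1 : S.Lam).1 = Matrix.diagonal S.unit := rfl

instance : Ring S.Lam where
  __ := (inferInstance : NonUnitalRing S.Lam)
  one_mul X := ext (by
    ext i j
    rw [val_mul, val_one, Matrix.diagonal_mul]
    by_cases h : i ≤ j
    · exact S.unit_mul h (X.2.1 i j h)
    · rw [X.2.2 i j h, mul_zero])
  mul_one X := ext (by
    ext i j
    rw [val_mul, val_one, Matrix.mul_diagonal]
    by_cases h : i ≤ j
    · exact S.mul_unit h (X.2.1 i j h)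
    · rw [X.2.2 i j h, zero_mul])

instance : Algebra K S.Lam :=
  Algebra.ofModule (fun c X Y => ext (by simp only [val_mul, val_smul, smul_mul_assoc]))
    (fun c X Y => ext (by simp only [val_mul, val_smul, mul_smul_comm]))

end Lam

variable [DecidableEq P]

/-- The element `e_{i,i} r` of `Λ(R)`, for `r ∈ R_i`. -/
def diagElt (i : P) (r : S.Pt i) : S.Lam :=
  ⟨Matrix.single i i r.1,
    fun k l h => by
      by_cases hk : i = k ∧ i = l
      · obtain ⟨rfl, rfl⟩ := hk
        rw [Matrix.single_apply_same]; exact r.2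
      · rw [Matrix.single_apply_of_ne _ _ _ _ _ hk]; exact Submodule.zero_mem _,
    fun k l h => Matrix.single_apply_of_ne _ _ _ _ _ fun hk => h (hk.1.symm.trans hk.2).le⟩

theorem diagElt_mul (i : P) (r s : S.Pt i) :
    S.diagElt i (r * s) = S.diagElt i r * S.diagElt i s :=
  Lam.ext (Matrix.single_mul_single_same ..).symm

theorem diagElt_add (i : P) (r s : S.Pt i) :
    S.diagElt i (r + s) = S.diagElt i r + S.diagElt i s :=
  Lam.ext (Matrix.single_add i i r.1 s.1)

theorem diagElt_zero (i : P) : S.diagElt i 0 = 0 :=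
  Lam.ext (Matrix.single_zero i i)

theorem diagElt_smul (i : P) (c : K) (r : S.Pt i) :
    S.diagElt i (c • r) = c • S.diagElt i r :=
  Lam.ext (Matrix.smul_single c i i r.1).symm

/-- The idempotent `e_i = e_{i,i} 1_i` of `Λ(R)`. -/
def idem (i : P) : S.Lam := S.diagElt i 1

/-- For `x ∈ Λ e_i` and `r ∈ R_i`, the product `x r` (the right `R_i`-action on `Λ e_i`). -/
def mulPt (i : P) (r : S.Pt i) : ↥(leftIdeal (S.idem i)) →ₗ[K] ↥(leftIdeal (S.idem i)) where
  toFun x := ⟨x.1 * S.diagElt i r, by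
    refine Submodule.mem_span_singleton.2 ⟨x.1 * S.diagElt i r, ?_⟩
    change x.1 * S.diagElt i r * S.diagElt i 1 = x.1 * S.diagElt i r
    rw [mul_assoc, ← diagElt_mul, mul_one]⟩
  map_add' x y := Subtype.ext (add_mul x.1 y.1 _)
  map_smul' c x := Subtype.ext (smul_mul_assoc c x.1 _)

theorem mulPt_apply (i : P) (r : S.Pt i) (x : ↥(leftIdeal (S.idem i))) :
    (S.mulPt i r x).1 = x.1 * S.diagElt i r := rfl

theorem mul_idem_of_mem (i : P) (x : ↥(leftIdeal (S.idem i))) :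
    x.1 * S.diagElt i 1 = x.1 := by
  obtain ⟨a, ha⟩ := Submodule.mem_span_singleton.1 x.2
  rw [← ha]
  change a * S.diagElt i 1 * S.diagElt i 1 = a * S.diagElt i 1
  rw [mul_assoc, ← diagElt_mul, mul_one]

variable [OrderTop P]

/-- The right `Λ`-module `E = D(Λ e_m)`, where `m = ⊤`. As `Λ e_m` is a `Λ`-`R_m`-bimodule, `E`
is an `R_m`-`Λ`-bimodule: `(r f)(x) = f (x r)` and `(f a)(x) = f (a x)`. -/
def E : Type _ := D K ↥(leftIdeal (S.idem (⊤ : P)))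

namespace E

variable {S}

instance : AddCommGroup S.E := inferInstanceAs (AddCommGroup (D K ↥(leftIdeal (S.idem (⊤ : P)))))
instance : Module K S.E := inferInstanceAs (Module K (D K ↥(leftIdeal (S.idem (⊤ : P)))))
instance : Module S.Lamᵐᵒᵖ S.E :=
  inferInstanceAs (Module S.Lamᵐᵒᵖ (D K ↥(leftIdeal (S.idem (⊤ : P)))))
instance : FunLike S.E ↥(leftIdeal (S.idem (⊤ : P))) K :=
  inferInstanceAs (FunLike (D K ↥(leftIdeal (S.idem (⊤ : P)))) ↥(leftIdeal (S.idem (⊤ : P))) K)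
instance : LinearMapClass S.E K ↥(leftIdeal (S.idem (⊤ : P))) K :=
  inferInstanceAs (LinearMapClass (D K ↥(leftIdeal (S.idem (⊤ : P)))) K _ K)

@[ext] theorem ext {f g : S.E} (h : ∀ x, f x = g x) : f = g := LinearMap.ext h

theorem add_apply (f g : S.E) (x : ↥(leftIdeal (S.idem (⊤ : P)))) : (f + g) x = f x + g x := rfl
theorem zero_apply (x : ↥(leftIdeal (S.idem (⊤ : P)))) : (0 : S.E) x = 0 := rfl
theorem smul_apply (c : K) (f : S.E) (x : ↥(leftIdeal (S.idem (⊤ : P)))) :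
    (c • f) x = c * f x := rfl
theorem op_smul_apply (a : S.Lamᵐᵒᵖ) (f : S.E) (x : ↥(leftIdeal (S.idem (⊤ : P)))) :
    (a • f) x = f (a.unop • x) := rfl

instance : SMul (S.Pt ⊤) S.E where
  smul r f := (show ↥(leftIdeal (S.idem (⊤ : P))) →ₗ[K] K from f) ∘ₗ S.mulPt ⊤ r

theorem pt_smul_apply (r : S.Pt ⊤) (f : S.E) (x : ↥(leftIdeal (S.idem (⊤ : P)))) :
    (r • f) x = f (S.mulPt ⊤ r x) := rfl

instance : Module (S.Pt ⊤) S.E where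
  one_smul f := by
    ext x
    rw [pt_smul_apply]
    congr 1
    exact Subtype.ext (S.mul_idem_of_mem ⊤ x)
  mul_smul r s f := by
    ext x
    simp only [pt_smul_apply]
    congr 1
    exact Subtype.ext (by simp only [mulPt_apply, diagElt_mul, mul_assoc])
  smul_zero r := by ext x; rfl
  smul_add r f g := by ext x; rfl
  add_smul r s f := by
    ext x
    rw [add_apply, pt_smul_apply, pt_smul_apply, pt_smul_apply, ← map_add]
    congr 1
    exact Subtype.ext (by simp only [mulPt_apply, diagElt_add, mul_add, Submodule.coe_add])
  zero_smul f := by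
    ext x
    rw [pt_smul_apply, zero_apply, ← map_zero f]
    congr 1
    exact Subtype.ext (by simp only [mulPt_apply, diagElt_zero, mul_zero, Submodule.coe_zero])

instance : SMulCommClass (S.Pt ⊤) S.Lamᵐᵒᵖ S.E where
  smul_comm r a f := by
    ext x
    simp only [pt_smul_apply, op_smul_apply]
    congr 1
    exact Subtype.ext (by simp only [mulPt_apply, Submodule.coe_smul, smul_eq_mul, mul_assoc])

instance : SMulCommClass (S.Pt ⊤) K S.E where
  smul_comm r c f := by ext x; rfl

instance : SMulCommClass S.Lamᵐᵒᵖ K S.E where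
  smul_comm a c f := by ext x; rfl

instance : IsScalarTower K (S.Pt ⊤) S.E where
  smul_assoc c r f := by
    ext x
    rw [pt_smul_apply, smul_apply, pt_smul_apply, ← smul_eq_mul, ← map_smul]
    congr 1
    exact Subtype.ext (by
      simp only [mulPt_apply, diagElt_smul, mul_smul_comm, Submodule.coe_smul_of_tower])

instance : IsScalarTower K S.Lamᵐᵒᵖ S.E where
  smul_assoc c a f := by
    ext x
    rw [op_smul_apply, smul_apply, op_smul_apply, ← smul_eq_mul, ← map_smul,
      MulOpposite.unop_smul, smul_assoc]

end E

/-- The triangular matrix algebra `Λ̃ = [[R_m, E], [0, Λ]]`. -/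
abbrev LamTilde : Type _ := TriMat (S.Pt (⊤ : P)) S.E S.Lam

/-- The idempotent `e_0 = [[1_m, 0], [0, 0]]` of `Λ̃`. -/
def tildeIdemZero : S.LamTilde := ⟨1, 0, 0⟩

/-- The idempotent `e_i = [[0, 0], [0, e_i]]` of `Λ̃`, for `i ∈ P`. -/
def tildeIdem (i : P) : S.LamTilde := ⟨0, 0, S.idem i⟩

end MultSystem

end PeakAlg

end

noncomputable section

namespace PeakAlg

/-! ## Modules over a ring with a division idempotent -/

section Idempotent

universe u v w

variable {R : Type u} [Ring R]

/-! Everything rests on one situation. Let `B` be a finite-dimensional algebra and `e` an idempotent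
such that `eB = eBe` is a division ring and `uBe ≠ 0` for every nonzero `u`. Then `eB` is a simple
projective right module, and every nonzero right submodule of `B` contains a copy of it, so the
socle of `B` is a finite power of `eB`.

The dual `D(Be)` is an injective right module in which every nonzero submodule meets `D(Be)e`. Since
`eB = eBe` is a division ring, `D(Be)e` is the single orbit `θ·eB` of a functional `θ` with `θ(e) ≠
0`. Hence `D(Be)` is an injective envelope of `eB` (`isInjectiveEnvelope_dual`). If moreover `D(Be)
≅ fB` for an idempotent `f`, then `fB` is projective and injective, and some power of it is an
injective envelope of `B` (`exists_isInjectiveEnvelope_pi`, `isOneGorenstein_of_idem`). Such an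
isomorphism comes from a functional on `B` for which `(a, y) ↦ θ(ay)` is nondegenerate on `fB × Be`
(`toDual_bijective`).

For `Λ` take `e = e_m`: because `m` is greatest, `e_m Λ` reduces to `R_m`, and iterating
admissibility up the finite poset gives `XΛe_m ≠ 0` for `X ≠ 0`. For `Λ̃` take `e = e_m` and `f =
e_0`, with the functional `(r, x, a) ↦ x(e_m)`. The left peak property uses the mirror situation for
`e_0`. With a least element `z`, take `f = e_z` in `Λ`; the pairing is multiplication `R_{z,i} ×
R_{i,m} → R_{z,m}` followed by a functional, nondegenerate by admissibility on one side and by a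
dimension count on the other. -/

theorem projective_span_singleton {M : Type*} [AddCommGroup M] [Module R M] (m : M)
    (φ : M →ₗ[R] R) (h : φ m • m = m) : Module.Projective R (Submodule.span R {m}) := by
  refine Module.Projective.of_split (φ ∘ₗ (Submodule.span R {m}).subtype)
    ((LinearMap.toSpanSingleton R M m).codRestrict (Submodule.span R {m})
      fun r => Submodule.mem_span_singleton.2 ⟨r, rfl⟩) ?_
  ext ⟨x, hx⟩
  obtain ⟨a, rfl⟩ := Submodule.mem_span_singleton.1 hx
  simp [mul_smul, h]

theorem projective_span_idem {e : R} (he : IsIdempotentElem e) :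
    Module.Projective R (Submodule.span R {e}) :=
  projective_span_singleton e LinearMap.id he

theorem isSimpleModule_span_idem {e : R} (h0 : e ≠ 0)
    (hdiv : ∀ x : R, x * e ≠ 0 → ∃ y : R, y * (x * e) = e) :
    IsSimpleModule R (Submodule.span R {e}) := by
  rw [isSimpleModule_iff_toSpanSingleton_surjective]
  refine ⟨⟨0, ⟨e, Submodule.mem_span_singleton_self e⟩, fun h => h0 (congrArg Subtype.val h).symm⟩,
    fun ⟨x, hx⟩ hne ⟨z, hz⟩ => ?_⟩
  obtain ⟨a, rfl⟩ := Submodule.mem_span_singleton.1 hx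
  obtain ⟨b, rfl⟩ := Submodule.mem_span_singleton.1 hz
  obtain ⟨y, hy⟩ := hdiv a fun h => hne (Subtype.ext h)
  refine ⟨b * y, Subtype.ext ?_⟩
  change b * y * (a * e) = b * e
  rw [mul_assoc, hy]

variable {e : R} {M : Type v} [AddCommGroup M] [Module R M]

/-- The homomorphism `R e → M`, `x ↦ x u`. -/
def idemHom (e : R) (u : M) : Submodule.span R {e} →ₗ[R] M :=
  LinearMap.toSpanSingleton R M u ∘ₗ (Submodule.span R {e}).subtype

theorem mem_range_idemHom (u : M) : e • u ∈ LinearMap.range (idemHom e u) :=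
  ⟨⟨e, Submodule.mem_span_singleton_self e⟩, rfl⟩

theorem idemHom_injective [IsSimpleModule R (Submodule.span R {e})] {u : M} (hu : e • u ≠ 0) :
    Function.Injective (idemHom e u) := by
  refine (idemHom e u).injective_or_eq_zero.resolve_right fun h => hu ?_
  simpa [h] using mem_range_idemHom (e := e) u

/-- If `R e` is simple and every nonzero element `u` of `M` has `e R u ≠ 0`, then the socle of `M`
is the sum of the submodules isomorphic to `R e`. -/
theorem socle_eq_isotypicComponent [IsSimpleModule R (Submodule.span R {e})]
    (hM : ∀ u : M, u ≠ 0 → ∃ b : R, e • b • u ≠ 0) :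
    socle R M = isotypicComponent R M (Submodule.span R {e}) := by
  refine le_antisymm (sSup_le fun N hN => le_sSup ?_)
    (sSup_le fun N ⟨f⟩ => le_sSup (IsSimpleModule.congr f))
  have hN' : IsSimpleModule R N := hN
  have := IsSimpleModule.nontrivial R N
  obtain ⟨u, hu⟩ := exists_ne (0 : N)
  obtain ⟨b, hb⟩ := hM u.1 fun h => hu (Subtype.ext h)
  have hb' : e • b • u ≠ 0 := fun h => hb (congrArg Subtype.val h)
  exact ⟨(LinearEquiv.ofBijective _ ((idemHom e (b • u)).bijective_of_ne_zero fun h =>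
    hb' (by simpa [h] using mem_range_idemHom (e := e) (b • u)))).symm⟩

/-- The map `x ↦ x u` sends `e` to `e • u`; if that is nonzero, it embeds the simple module `R e`,
and its image is a simple submodule containing `e • u`. -/
theorem smul_mem_socle [IsSimpleModule R (Submodule.span R {e})] (u : M) :
    e • u ∈ socle R M := by
  by_cases h : e • u = 0
  · rw [h]; exact Submodule.zero_mem _
  · have : LinearMap.range (idemHom e u) ≤ socle R M :=
      le_sSup (IsSimpleModule.congr (LinearEquiv.ofInjective _ (idemHom_injective h)).symm)
    exact this (mem_range_idemHom u)

theorem exists_socle_linearEquiv [IsNoetherian R M] [IsSimpleModule R (Submodule.span R {e})]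
    (hM : ∀ u : M, u ≠ 0 → ∃ b : R, e • b • u ≠ 0) :
    ∃ n : ℕ, Nonempty (socle R M ≃ₗ[R] (Fin n → Submodule.span R {e})) := by
  rw [socle_eq_isotypicComponent hM]
  exact (IsIsotypicOfType.isotypicComponent R M (Submodule.span R {e})).linearEquiv_fun

theorem hasPeakSocle_of_idem {M : Type u} [AddCommGroup M] [Module R M] [IsNoetherian R M]
    (he : IsIdempotentElem e) [IsSimpleModule R (Submodule.span R {e})]
    (hM : ∀ u : M, u ≠ 0 → ∃ b : R, e • b • u ≠ 0) : HasPeakSocle R M :=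
  ⟨Submodule.span R {e}, inferInstance, inferInstance, inferInstance, projective_span_idem he,
    exists_socle_linearEquiv hM⟩

/-- If `R e` is simple, `e Q = e R q₀` for an element `q₀ = e q₀ ≠ 0` of the injective module `Q`,
and `M` and `Q` have no nonzero elements `u` with `e R u = 0`, then a power of `Q` is an injective
envelope of `M`. -/
theorem exists_isInjectiveEnvelope_pi {Q : Type w} [AddCommGroup Q] [Module R Q] [Small.{w} R]
    [Module.Injective R Q] [IsNoetherian R M] [IsSimpleModule R (Submodule.span R {e})]
    (hM : ∀ u : M, u ≠ 0 → ∃ b : R, e • b • u ≠ 0)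
    (hQ : ∀ u : Q, u ≠ 0 → ∃ b : R, e • b • u ≠ 0)
    {q₀ : Q} (hq₀ : q₀ ≠ 0) (heq₀ : e • q₀ = q₀) (hq : ∀ q : Q, ∃ a : R, e • q = a • q₀) :
    ∃ n : ℕ, IsInjectiveEnvelope R M (Fin n → Q) := by
  obtain ⟨n, ⟨φ⟩⟩ := exists_socle_linearEquiv (e := e) hM
  have hι : Function.Injective (idemHom e q₀) := idemHom_injective (by rwa [heq₀])
  let ψ : (Fin n → Submodule.span R {e}) →ₗ[R] (Fin n → Q) :=
    LinearMap.pi fun i => idemHom e q₀ ∘ₗ LinearMap.proj i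
  have hψ : Function.Injective ψ := fun x y hxy => funext fun i => hι (congrFun hxy i)
  -- The socle is a power of `R e`, which embeds coordinatewise in the same power of `Q` by `e ↦
  -- q₀`; injectivity extends this embedding to all of `M`.
  obtain ⟨g, hg⟩ := Module.Injective.extension_property R (Fin n → Q) (socle R M) M
    (socle R M).subtype (Submodule.subtype_injective _) (ψ ∘ₗ φ.toLinearMap)
  have hg' (x : socle R M) : g x.1 = ψ (φ x) := LinearMap.congr_fun hg x
  refine ⟨n, inferInstance, g, ?_, fun N hN => ?_⟩
  · rw [injective_iff_map_eq_zero]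
    intro u hu
    by_contra hne
    -- A nonzero kernel element would give a nonzero socle element `e b u` in the kernel, but `g` is
    -- injective on the socle.
    obtain ⟨b, hb⟩ := hM u hne
    refine hb (congrArg Subtype.val (φ.injective (hψ (?_ :
      ψ (φ ⟨e • b • u, smul_mem_socle _⟩) = ψ (φ 0)))))
    rw [← hg', map_zero, map_zero, map_smul, map_smul, hu, smul_zero, smul_zero]
  · obtain ⟨v, hvN, hv⟩ := N.ne_bot_iff.1 hN
    obtain ⟨i, hi⟩ := Function.ne_iff.1 hv
    obtain ⟨b, hb⟩ := hQ (v i) hi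
    refine Submodule.ne_bot_iff _ |>.2 ⟨e • b • v,
      ⟨N.smul_mem _ (N.smul_mem _ hvN), ?_⟩, fun h => hb (congrFun h i)⟩
    -- Essentiality: each coordinate of `e b v` is some `a i • q₀`, so `e b v` is already the image
    -- of the socle element with coordinates `a i * e`.
    choose a ha using fun i => hq (b • v i)
    refine ⟨(φ.symm fun i => ⟨a i * e, Submodule.mem_span_singleton.2 ⟨a i, rfl⟩⟩).1, ?_⟩
    rw [hg', LinearEquiv.apply_symm_apply]
    funext i
    change (a i * e) • q₀ = e • b • v i
    rw [mul_smul, heq₀, ha]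

end Idempotent

/-! ## Duals of left ideals generated by idempotents -/

section Dual

variable {K : Type*} [Field K] {B : Type*} [Ring B] [Algebra K B] {e f : B}

theorem mem_leftIdeal_iff (he : IsIdempotentElem e) {x : B} : x ∈ leftIdeal e ↔ x * e = x := by
  refine ⟨fun h => ?_, fun h => Submodule.mem_span_singleton.2 ⟨x, h⟩⟩
  obtain ⟨a, rfl⟩ := Submodule.mem_span_singleton.1 h
  exact (mul_assoc a e e).trans (congrArg (a * ·) he.eq)

theorem mem_rightIdeal_iff (he : IsIdempotentElem e) {x : B} :
    x ∈ rightIdeal e ↔ e * x = x := by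
  refine ⟨fun h => ?_, fun h => Submodule.mem_span_singleton.2 ⟨.op x, h⟩⟩
  obtain ⟨a, rfl⟩ := Submodule.mem_span_singleton.1 h
  exact (mul_assoc e e a.unop).symm.trans (congrArg (· * a.unop) he.eq)

theorem projective_rightIdeal (he : IsIdempotentElem e) :
    Module.Projective Bᵐᵒᵖ (rightIdeal e) :=
  projective_span_singleton (M := B) e
    { toFun := MulOpposite.op, map_add' := fun _ _ => rfl, map_smul' := fun _ _ => rfl } he

theorem D.map_smul (g : D K (leftIdeal e)) (c : K) (x : leftIdeal e) : g (c • x) = c * g x :=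
  LinearMap.map_smul (show leftIdeal e →ₗ[K] K from g) c x

variable (e) in
/-- The homomorphism of right modules `B → D(B e)`, `a ↦ (y ↦ θ(a y))`. -/
def toDual (θ : B →ₗ[K] K) : B →ₗ[Bᵐᵒᵖ] D K (leftIdeal e) where
  toFun a := θ ∘ₗ LinearMap.mulLeft K a ∘ₗ (leftIdeal e).subtype.restrictScalars K
  map_add' a b := D.ext fun y => by
    change θ ((a + b) * y.1) = θ (a * y.1) + θ (b * y.1)
    rw [add_mul, map_add]
  map_smul' b a := D.ext fun y => by
    change θ (a * b.unop * y.1) = θ (a * (b.unop * y.1))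
    rw [mul_assoc]

theorem toDual_apply (θ : B →ₗ[K] K) (a : B) (y : leftIdeal e) :
    toDual e θ a y = θ (a * y.1) := rfl

/-- As `y = y e` on `B e`, a homomorphism `g : I → D(B e)` satisfies `g(x)(y) = g(xy)(e)`, so it is
encoded by the single functional `x ↦ g(x)(e)` on `I`. Extending that functional to `B` as a linear
form extends `g`. -/
theorem baer_dual_leftIdeal (he : IsIdempotentElem e) :
    Module.Baer Bᵐᵒᵖ (D K (leftIdeal e)) := by
  intro I g
  let e' : leftIdeal e := ⟨e, Submodule.mem_span_singleton_self e⟩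
  let J : Submodule K Bᵐᵒᵖ := I.restrictScalars K
  have hg (x : I) (y : leftIdeal e) : g x y = g (MulOpposite.op y.1 • x) e' := by
    rw [_root_.map_smul, D.op_smul_apply]
    exact congrArg (g x) (Subtype.ext ((mem_leftIdeal_iff he).1 y.2).symm)
  let γ : J →ₗ[K] K :=
    { toFun := fun x => g x e'
      map_add' := fun x y => DFunLike.congr_fun (g.map_add (x : I) (y : I)) e'
      map_smul' := fun c x => by
        -- Scalars act on `I` through their images in `B`, which turns `B`-linearity of `g` into
        -- `K`-linearity of the functional.
        have h : (c • x : J) = (MulOpposite.op (algebraMap K B c) • (x : I) : I) :=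
          Subtype.ext (Algebra.smul_def c x.1)
        refine (congrArg (fun z : I => g z e') h).trans ((DFunLike.congr_fun
          (g.map_smul (MulOpposite.op (algebraMap K B c)) (x : I)) e').trans ?_)
        change g x (algebraMap K B c • e') = c * _
        rw [algebraMap_smul, D.map_smul] }
  obtain ⟨γ', hγ'⟩ := LinearMap.exists_extend γ
  let θ : B →ₗ[K] K := γ' ∘ₗ (MulOpposite.opLinearEquiv K).toLinearMap
  refine ⟨toDual e θ ∘ₗ LinearMap.toSpanSingleton Bᵐᵒᵖ B 1, fun x hx => D.ext fun y => ?_⟩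
  rw [hg]
  change γ' (MulOpposite.op (1 * x.unop * y.1)) = γ ⟨_, I.smul_mem (MulOpposite.op y.1) hx⟩
  rw [← hγ', one_mul]
  rfl

/-- For `y` in `B e`, the functional `q y e` takes the value `q(y)` at `e`, so if all these
functionals vanish then `q = 0`. -/
theorem eq_smul_idem (he : IsIdempotentElem e) (q : D K (leftIdeal e)) (hq : q ≠ 0) :
    ∃ b : Bᵐᵒᵖ, MulOpposite.op e • b • q ≠ 0 := by
  by_contra! h
  refine hq (D.ext fun y => ?_)
  have := DFunLike.congr_fun (h (MulOpposite.op y.1)) ⟨e, Submodule.mem_span_singleton_self e⟩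
  rw [D.op_smul_apply, D.op_smul_apply] at this
  refine Eq.trans (congrArg q (Subtype.ext ?_)) this
  change y.1 = y.1 * (e * e)
  rw [he.eq, (mem_leftIdeal_iff he).1 y.2]

/-- A perfect pairing `f B × B e → K` induced by a functional on `B` identifies `f B` with
`D(B e)`. -/
theorem toDual_bijective [FiniteDimensional K B] (θ : B →ₗ[K] K)
    (hl : ∀ a ∈ rightIdeal f, a ≠ 0 → ∃ y ∈ leftIdeal e, θ (a * y) ≠ 0)
    (hr : ∀ y ∈ leftIdeal e, y ≠ 0 → ∃ a ∈ rightIdeal f, θ (a * y) ≠ 0) :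
    Function.Bijective (toDual e θ ∘ₗ (rightIdeal f).subtype) := by
  let p : rightIdeal f →ₗ[K] leftIdeal e →ₗ[K] K :=
    LinearMap.mk₂ K (fun a y => θ (a.1 * y.1))
      (fun a b y => by simp [add_mul]) (fun c a y => by simp)
      (fun a y z => by simp [mul_add]) (fun c a y => by simp)
  have : FiniteDimensional K (rightIdeal f) :=
    FiniteDimensional.finiteDimensional_submodule ((rightIdeal f).restrictScalars K)
  have : FiniteDimensional K (leftIdeal e) :=
    FiniteDimensional.finiteDimensional_submodule ((leftIdeal e).restrictScalars K)
  have h1 : Function.Injective p := by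
    rw [injective_iff_map_eq_zero]
    intro a ha
    by_contra hne
    obtain ⟨y, hy, h⟩ := hl a.1 a.2 fun h => hne (Subtype.ext h)
    exact h (LinearMap.congr_fun ha ⟨y, hy⟩)
  have h2 : Function.Injective p.flip := by
    rw [injective_iff_map_eq_zero]
    intro y hy
    by_contra hne
    obtain ⟨a, ha, h⟩ := hr y.1 y.2 fun h => hne (Subtype.ext h)
    exact h (LinearMap.congr_fun hy ⟨a, ha⟩)
  exact (LinearMap.IsPerfPair.of_injective h1 h2).bijective_left

/-- If `e B = e B e` is a division algebra of finite dimension, then the functionals on `e B` are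
induced by right multiplications. -/
theorem exists_toDual_eq [FiniteDimensional K B] (he : IsIdempotentElem e)
    (hcor : ∀ b : B, e * b * e = e * b) (hdiv : ∀ x : B, e * x ≠ 0 → ∃ y : B, e * x * y = e)
    {θ : B →ₗ[K] K} (hθ : θ e ≠ 0) (q : D K (leftIdeal e)) :
    ∃ a ∈ rightIdeal e, MulOpposite.op e • q = toDual e θ a := by
  have hfin : FiniteDimensional K (rightIdeal e) :=
    FiniteDimensional.finiteDimensional_submodule ((rightIdeal e).restrictScalars K)
  let p : rightIdeal e →ₗ[K] Module.Dual K (rightIdeal e) :=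
    LinearMap.mk₂ K (fun a y => θ (a.1 * y.1))
      (fun a b y => by simp [add_mul]) (fun c a y => by simp)
      (fun a y z => by simp [mul_add]) (fun c a y => by simp)
  have h1 : Function.Injective p := by
    rw [injective_iff_map_eq_zero]
    intro a ha
    by_contra hne
    have hea := (mem_rightIdeal_iff he).1 a.2
    have hae : a.1 * e = a.1 := by rw [← hea, hcor]
    obtain ⟨y, hy⟩ := hdiv a.1 fun h => hne (Subtype.ext (hea.symm.trans h))
    refine hθ ?_
    have := LinearMap.congr_fun ha ⟨e * y, (mem_rightIdeal_iff he).2 (by rw [← mul_assoc, he.eq])⟩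
    change θ (a.1 * (e * y)) = 0 at this
    rwa [← mul_assoc, hae, ← hea, hy] at this
  have h2 : Function.Surjective p :=
    -- The form `θ(ay)` on `eB` has no left kernel since `a` is invertible there and `θ(e) ≠ 0`;
    -- equal dimensions then make every functional on `eB` of the form `θ(a ·)`.
    (LinearMap.injective_iff_surjective_of_finrank_eq_finrank
      Subspace.dual_finrank_eq.symm).1 h1
  -- By `hcor`, `eB` lies inside `Be`, so `q` restricts to it.
  have hle (y : rightIdeal e) : y.1 ∈ leftIdeal e := by
    rw [mem_leftIdeal_iff he, ← (mem_rightIdeal_iff he).1 y.2, hcor]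
  obtain ⟨a, ha⟩ := h2
    { toFun := fun y => q ⟨y.1, hle y⟩
      map_add' := fun y z => map_add q ⟨y.1, hle y⟩ ⟨z.1, hle z⟩
      map_smul' := fun c y => D.map_smul q c ⟨y.1, hle y⟩ }
  refine ⟨a.1, a.2, D.ext fun y => ?_⟩
  have h := LinearMap.congr_fun ha
    ⟨e * y.1, (mem_rightIdeal_iff he).2 (by rw [← mul_assoc, he.eq])⟩
  change θ (a.1 * (e * y.1)) = q (e • y) at h
  rw [toDual_apply, D.op_smul_apply]
  refine h.symm.trans ?_
  rw [← mul_assoc, ← (mem_rightIdeal_iff he).1 a.2, hcor]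

end Dual

/-! ### Finite-dimensional algebras whose socle is generated by one division idempotent -/

section Peak

universe u

variable {B : Type u} [Ring B] {e f : B}

theorem isSimpleModule_span_op_idem (h0 : e ≠ 0)
    (hdiv : ∀ x : B, e * x ≠ 0 → ∃ y : B, e * x * y = e) :
    IsSimpleModule Bᵐᵒᵖ (Submodule.span Bᵐᵒᵖ {MulOpposite.op e}) := by
  refine isSimpleModule_span_idem (fun h => h0 (MulOpposite.op_injective h)) fun x hx => ?_
  obtain ⟨y, hy⟩ := hdiv x.unop fun h => hx (MulOpposite.unop_injective h)
  exact ⟨.op y, MulOpposite.unop_injective hy⟩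

theorem isLeftPeak_of_idem (K : Type*) [Field K] [Algebra K B] [FiniteDimensional K B]
    (he : IsIdempotentElem e) (h0 : e ≠ 0)
    (hdiv : ∀ x : B, x * e ≠ 0 → ∃ y : B, y * (x * e) = e)
    (hB : ∀ u : B, u ≠ 0 → ∃ b : B, e * (b * u) ≠ 0) : IsLeftPeak B :=
  have : IsNoetherian B B := isNoetherian_of_tower K inferInstance
  have := isSimpleModule_span_idem h0 hdiv
  hasPeakSocle_of_idem he hB

theorem isRightPeak_of_idem (K : Type*) [Field K] [Algebra K B] [FiniteDimensional K B]
    (he : IsIdempotentElem e) (h0 : e ≠ 0)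
    (hdiv : ∀ x : B, e * x ≠ 0 → ∃ y : B, e * x * y = e)
    (hB : ∀ u : B, u ≠ 0 → ∃ b : B, u * b * e ≠ 0) : IsRightPeak B :=
  have : IsNoetherian Bᵐᵒᵖ B := isNoetherian_of_tower K inferInstance
  have := isSimpleModule_span_op_idem h0 hdiv
  hasPeakSocle_of_idem (e := MulOpposite.op e) (MulOpposite.unop_injective he) fun u hu =>
    let ⟨b, hb⟩ := hB u hu
    ⟨.op b, hb⟩

variable {K : Type*} [Field K] [Algebra K B] [FiniteDimensional K B]

/-- The embedding is `a ↦ θ(a ·)` with `θ(e) ≠ 0`: if `a y = e`, then `θ(a ·)` is nonzero at `y e`.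
It is essential because a nonzero submodule contains a nonzero `q b e`, and `exists_toDual_eq` puts
every such functional in the image. -/
theorem isInjectiveEnvelope_dual (he : IsIdempotentElem e) (h0 : e ≠ 0)
    (hcor : ∀ b : B, e * b * e = e * b) (hdiv : ∀ x : B, e * x ≠ 0 → ∃ y : B, e * x * y = e) :
    IsInjectiveEnvelope Bᵐᵒᵖ (rightIdeal e) (D K (leftIdeal e)) := by
  obtain ⟨θ, hθ⟩ := Module.Projective.exists_dual_ne_zero K h0
  refine ⟨(baer_dual_leftIdeal he).injective, toDual e θ ∘ₗ (rightIdeal e).subtype, ?_,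
    fun N hN => ?_⟩
  · rw [injective_iff_map_eq_zero]
    intro a ha
    by_contra hne
    have hea := (mem_rightIdeal_iff he).1 a.2
    obtain ⟨y, hy⟩ := hdiv a.1 fun h => hne (Subtype.ext (hea.symm.trans h))
    have := DFunLike.congr_fun ha ⟨y * e, Submodule.mem_span_singleton.2 ⟨y, rfl⟩⟩
    change θ (a.1 * (y * e)) = 0 at this
    rw [← mul_assoc, ← hea, hy, he.eq] at this
    exact hθ this
  · obtain ⟨q, hqN, hq⟩ := N.ne_bot_iff.1 hN
    obtain ⟨b, hb⟩ := eq_smul_idem he q hq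
    obtain ⟨a, ha, h⟩ := exists_toDual_eq he hcor hdiv hθ (b • q)
    exact (Submodule.ne_bot_iff _).2
      ⟨_, ⟨N.smul_mem _ (N.smul_mem b hqN), ⟨⟨a, ha⟩, h.symm⟩⟩, hb⟩

/-- If `e B = e B e` is a division algebra, `u B e ≠ 0` for all `u ≠ 0`, and `f B ≅ D(B e)`
for an idempotent `f`, then `B` is 1-Gorenstein. -/
theorem isOneGorenstein_of_idem (he : IsIdempotentElem e) (h0 : e ≠ 0)
    (hcor : ∀ b : B, e * b * e = e * b) (hdiv : ∀ x : B, e * x ≠ 0 → ∃ y : B, e * x * y = e)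
    (hB : ∀ u : B, u ≠ 0 → ∃ b : B, u * b * e ≠ 0) (hf : IsIdempotentElem f)
    (φ : rightIdeal f ≃ₗ[Bᵐᵒᵖ] D K (leftIdeal e)) : IsOneGorenstein B := by
  have : IsNoetherian Bᵐᵒᵖ B := isNoetherian_of_tower K inferInstance
  have := isSimpleModule_span_op_idem h0 hdiv
  have := projective_rightIdeal hf
  -- Baer's criterion is transported along `φ` because `f B` and `D(B e)` may live in different
  -- universes.
  have : Module.Injective Bᵐᵒᵖ (rightIdeal f) :=
    Module.Baer.injective fun I g => by
      obtain ⟨g', hg'⟩ := baer_dual_leftIdeal he I (φ.toLinearMap ∘ₗ g)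
      exact ⟨φ.symm.toLinearMap ∘ₗ g', fun x hx => by
        rw [LinearMap.comp_apply, hg' x hx]; exact φ.symm_apply_apply _⟩
  obtain ⟨θ, hθ⟩ := Module.Projective.exists_dual_ne_zero K h0
  have hne : toDual e θ e ≠ 0 := fun h => hθ <| by
    have := DFunLike.congr_fun h ⟨e, Submodule.mem_span_singleton_self e⟩
    rwa [toDual_apply, he.eq] at this
  obtain ⟨n, hn⟩ := exists_isInjectiveEnvelope_pi (R := Bᵐᵒᵖ) (M := B) (Q := rightIdeal f)
    (e := MulOpposite.op e) (fun u hu => let ⟨b, hb⟩ := hB u hu; ⟨.op b, hb⟩)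
    (fun u hu => by
      obtain ⟨b, hb⟩ := eq_smul_idem he (φ u) (by simpa using hu)
      refine ⟨b, fun h => hb ?_⟩
      rw [← map_smul, ← map_smul, h, map_zero])
    (q₀ := φ.symm (toDual e θ e)) (by simpa using hne)
    (by
      rw [← map_smul, ← map_smul]
      exact congrArg (fun x => φ.symm (toDual e θ x)) he.eq)
    (fun q => by
      obtain ⟨a, ha, h⟩ := exists_toDual_eq he hcor hdiv hθ (φ q)
      refine ⟨.op a, φ.injective ?_⟩
      rw [map_smul, h, map_smul, LinearEquiv.apply_symm_apply, ← map_smul]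
      exact congrArg (toDual e θ) ((mem_rightIdeal_iff he).1 ha).symm)
  have : Module.Projective Bᵐᵒᵖ (Fin n → rightIdeal f) :=
    Module.Projective.of_equiv (DirectSum.linearEquivFunOnFintype Bᵐᵒᵖ (Fin n) fun _ => rightIdeal f)
  exact ⟨Fin n → rightIdeal f, inferInstance, inferInstance, hn, inferInstance⟩

end Peak

/-! ## Incidence algebras -/

namespace MultSystem

variable {K A P : Type*} [Field K] [Ring A] [Algebra K A] [PartialOrder P]
variable {S : MultSystem K A P}

/-- Admissibility moves a nonzero product strictly upwards as long as `j` is not greatest; in a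
finite poset this ends at `⊤`, where the unit of `R_⊤` serves as `y`. -/
theorem IsAdmissible.exists_mul_top_ne_zero [OrderTop P] [Finite P] (hS : S.IsAdmissible) {j : P} :
    ∀ {i : P} (hij : i ≤ j), ∀ x ∈ S.R hij, x ≠ 0 →
      ∃ y ∈ S.R (le_top : j ≤ ⊤), x * y ≠ 0 := by
  induction j using WellFoundedGT.induction with
  | ind j ih =>
    intro i hij x hx hx0
    by_cases hj : j = ⊤
    · subst hj
      exact ⟨S.unit ⊤, S.unit_mem ⊤, by rwa [S.mul_unit hij hx]⟩
    · obtain ⟨l, hjl, hne, y, hy, hxy⟩ :=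
        hS.exists_mul_ne_zero hij (lt_top_iff_ne_top.2 hj) x hx hx0
      obtain ⟨w, hw, hxyw⟩ := ih l (lt_of_le_of_ne hjl hne.symm) (hij.trans hjl) (x * y)
        (S.mul_mem hij hjl hx hy) hxy
      exact ⟨y * w, S.mul_mem hjl le_top hy hw, by rwa [← mul_assoc]⟩

/-- Fix `w ≠ 0` in `R_{z,⊤}` and `F` with `F w ≠ 0`. Some product `xy` in `R_{z,⊤}` is nonzero, and
multiplying it on the right by the division ring `R_⊤` fills all of `R_{z,⊤}` by equality of
dimensions; in particular it reaches `w`. -/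
theorem exists_pairing [OrderTop P] [Finite P] (hS : S.IsAdmissible)
    (hfin : ∀ (i j : P) (h : i ≤ j), FiniteDimensional K (S.R h)) {z : P} (hz : ∀ i, z ≤ i)
    (hd : Module.finrank K (S.R (hz ⊤)) = Module.finrank K (S.R (le_refl (⊤ : P)))) :
    ∃ F : A →ₗ[K] K, ∀ (i : P), ∀ x ∈ S.R (hz i), x ≠ 0 →
      ∃ y ∈ S.R (le_top : i ≤ ⊤), F (x * y) ≠ 0 := by
  have := hfin
  have htop : 0 < Module.finrank K (S.R (le_refl (⊤ : P))) := by
    have : Nontrivial (S.R (le_refl (⊤ : P))) := hS.nontrivial ⊤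
    exact Module.finrank_pos
  have : Nontrivial (S.R (hz ⊤)) := Module.nontrivial_of_finrank_pos (R := K) (hd ▸ htop)
  obtain ⟨w, hw⟩ := exists_ne (0 : S.R (hz ⊤))
  obtain ⟨F, hF⟩ := Module.Projective.exists_dual_ne_zero K fun h => hw (Subtype.ext h : w = 0)
  refine ⟨F, fun i x hx hx0 => ?_⟩
  obtain ⟨y, hy, hxy⟩ := hS.exists_mul_top_ne_zero (hz i) x hx hx0
  let L : S.R (le_refl (⊤ : P)) →ₗ[K] S.R (hz ⊤) :=
    ((LinearMap.mulLeft K (x * y)).domRestrict _).codRestrict _ fun r =>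
      S.mul_mem (hz ⊤) le_rfl (S.mul_mem (hz i) le_top hx hy) r.2
  have hL : Function.Injective L := by
    rw [injective_iff_map_eq_zero]
    intro r hr
    by_contra hne
    -- A nonzero `r` killed by `xy` would be invertible, forcing `xy = xy·1_⊤ = 0`.
    obtain ⟨v, hv⟩ := (hS.isUnit_of_ne_zero ⊤ r hne).exists_right_inv
    have hr' : x * y * r.1 = 0 := congrArg Subtype.val hr
    have hv' : r.1 * v.1 = S.unit ⊤ := congrArg Subtype.val hv
    refine hxy ?_
    rw [← S.mul_unit (hz ⊤) (S.mul_mem (hz i) le_top hx hy), ← hv', ← mul_assoc, hr', zero_mul]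
  obtain ⟨r, hr⟩ := (LinearMap.injective_iff_surjective_of_finrank_eq_finrank hd.symm).1 hL w
  refine ⟨y * r.1, S.mul_mem le_top le_rfl hy r.2, ?_⟩
  rw [← mul_assoc, show x * y * r.1 = w from congrArg Subtype.val hr]
  exact hF

/-- Nondegeneracy on the left makes `R_{z,i}` inject into the dual of `R_{i,⊤}`; equal dimensions
make this onto, so some `x` realises a functional that is nonzero at `y`. -/
theorem exists_pairing_right [OrderTop P]
    (hfin : ∀ (i j : P) (h : i ≤ j), FiniteDimensional K (S.R h)) {z : P} (hz : ∀ i, z ≤ i) {i : P}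
    (hd : Module.finrank K (S.R (hz i)) = Module.finrank K (S.R (le_top : i ≤ ⊤)))
    {F : A →ₗ[K] K} (hF : ∀ x ∈ S.R (hz i), x ≠ 0 → ∃ y ∈ S.R (le_top : i ≤ ⊤), F (x * y) ≠ 0)
    {y : A} (hy : y ∈ S.R (le_top : i ≤ ⊤)) (hy0 : y ≠ 0) :
    ∃ x ∈ S.R (hz i), F (x * y) ≠ 0 := by
  have := hfin
  let p : S.R (hz i) →ₗ[K] Module.Dual K (S.R (le_top : i ≤ ⊤)) :=
    LinearMap.mk₂ K (fun a y => F (a.1 * y.1))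
      (fun a b y => by simp [add_mul]) (fun c a y => by simp)
      (fun a y z => by simp [mul_add]) (fun c a y => by simp)
  have hp : Function.Injective p := by
    rw [injective_iff_map_eq_zero]
    intro a ha
    by_contra hne
    obtain ⟨y, hy, h⟩ := hF a.1 a.2 fun h => hne (Subtype.ext h)
    exact h (LinearMap.congr_fun ha ⟨y, hy⟩)
  obtain ⟨θ, hθ⟩ := Module.Projective.exists_dual_ne_zero K
    fun h => hy0 (congrArg Subtype.val h : (⟨y, hy⟩ : S.R (le_top : i ≤ ⊤)).1 = 0)
  obtain ⟨x, hx⟩ := (LinearMap.injective_iff_surjective_of_finrank_eq_finrank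
    (hd.trans Subspace.dual_finrank_eq.symm)).1 hp θ
  exact ⟨x.1, x.2, fun h => hθ ((LinearMap.congr_fun hx ⟨y, hy⟩).symm.trans h)⟩

variable [Fintype P] [DecidableEq P]

/-- The element `e_{i,j} x` of `Λ(R)`, for `x ∈ R_{i,j}`. -/
def elt {i j : P} (h : i ≤ j) (x : S.R h) : S.Lam :=
  ⟨Matrix.single i j x.1,
    fun k l hkl => by
      by_cases hk : i = k ∧ j = l
      · obtain ⟨rfl, rfl⟩ := hk
        rw [Matrix.single_apply_same]; exact x.2
      · rw [Matrix.single_apply_of_ne _ _ _ _ _ hk]; exact Submodule.zero_mem _,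
    fun k l hkl => Matrix.single_apply_of_ne _ _ _ _ _ fun hk => hkl (hk.1 ▸ hk.2 ▸ h)⟩

theorem elt_mul_idem {i j : P} (h : i ≤ j) (x : S.R h) : elt h x * S.idem j = elt h x :=
  Lam.ext ((Matrix.single_mul_single_same ..).trans
    (congrArg (Matrix.single i j) (S.mul_unit h x.2)))

theorem idem_mul_elt {i j : P} (h : i ≤ j) (x : S.R h) : S.idem i * elt h x = elt h x :=
  Lam.ext ((Matrix.single_mul_single_same ..).trans
    (congrArg (Matrix.single i j) (S.unit_mul h x.2)))

theorem isIdempotentElem_idem (i : P) : IsIdempotentElem (S.idem i) := by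
  change S.diagElt i 1 * S.diagElt i 1 = S.diagElt i 1
  rw [← diagElt_mul, mul_one]

theorem mem_leftIdeal_idem {i : P} {x : S.Lam} : x ∈ leftIdeal (S.idem i) ↔ x * S.idem i = x :=
  mem_leftIdeal_iff (isIdempotentElem_idem i)

theorem val_idem_mul_of_ne (i : P) (X : S.Lam) {k : P} (hk : k ≠ i) (l : P) :
    (S.idem i * X).1 k l = 0 :=
  Matrix.single_mul_apply_of_ne _ _ _ _ _ hk _

theorem val_mul_idem_of_ne (i : P) (X : S.Lam) {l : P} (hl : l ≠ i) (k : P) :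
    (X * S.idem i).1 k l = 0 :=
  Matrix.mul_single_apply_of_ne _ _ _ _ _ hl _

theorem diagElt_injective (i : P) : Function.Injective (S.diagElt i) := fun r s h => by
  have := congrArg (fun X : S.Lam => X.1 i i) h
  exact Pt.ext (by simpa [diagElt] using this)

theorem diagElt_ne_zero {i : P} {r : S.Pt i} (hr : r ≠ 0) : S.diagElt i r ≠ 0 := fun h =>
  hr (S.diagElt_injective i (h.trans (S.diagElt_zero i).symm))

theorem Lam.exists_entry_ne_zero {X : S.Lam} (hX : X ≠ 0) :
    ∃ (i j : P) (_ : i ≤ j), X.1 i j ≠ 0 := by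
  by_contra! h
  refine hX (Lam.ext (Matrix.ext fun i j => ?_))
  by_cases hij : i ≤ j
  · exact h i j hij
  · exact X.2.2 i j hij

/-- The diagonal entry of an element of `Λ(R)` at the greatest element of `P`. -/
def Lam.topEntry [OrderTop P] (X : S.Lam) : S.Pt ⊤ := ⟨X.1 ⊤ ⊤, X.2.1 ⊤ ⊤ le_rfl⟩

/-- Nothing lies above `⊤`, so row `⊤` of an upper triangular matrix has only its diagonal entry. -/
theorem Lam.idem_top_mul [OrderTop P] (X : S.Lam) :
    S.idem ⊤ * X = S.diagElt ⊤ X.topEntry := by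
  refine Lam.ext (Matrix.ext fun i j => ?_)
  change (Matrix.single ⊤ ⊤ (S.unit ⊤) * X.1 : Matrix P P A) i j =
    Matrix.single ⊤ ⊤ (X.1 ⊤ ⊤) i j
  by_cases hi : i = ⊤
  · subst hi
    rw [Matrix.single_mul_apply_same]
    by_cases hj : j = ⊤
    · subst hj
      rw [S.unit_mul le_rfl (X.2.1 _ _ le_rfl), Matrix.single_apply_same]
    · rw [X.2.2 ⊤ j fun h => hj (top_le_iff.1 h), mul_zero,
        Matrix.single_apply_of_ne _ _ _ _ _ fun h => hj h.2.symm]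
  · rw [Matrix.single_mul_apply_of_ne _ _ _ _ _ hi,
      Matrix.single_apply_of_ne _ _ _ _ _ fun h => hi h.1.symm]

theorem finiteDimensional_lam (hfin : ∀ (i j : P) (h : i ≤ j), FiniteDimensional K (S.R h)) :
    FiniteDimensional K S.Lam := by
  have := hfin
  let L : S.Lam →ₗ[K] ((p : {p : P × P // p.1 ≤ p.2}) → S.R p.2) :=
    { toFun := fun X p => ⟨X.1 p.1.1 p.1.2, X.2.1 _ _ p.2⟩
      map_add' := fun X Y => rfl
      map_smul' := fun c X => rfl }
  refine FiniteDimensional.of_injective L fun X Y h => Lam.ext (Matrix.ext fun i j => ?_)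
  by_cases hij : i ≤ j
  · exact congrArg Subtype.val (congrFun h ⟨(i, j), hij⟩)
  · rw [X.2.2 i j hij, Y.2.2 i j hij]

variable [OrderTop P]

theorem idem_top_mul_mul_idem_top (X : S.Lam) :
    S.idem ⊤ * X * S.idem ⊤ = S.idem ⊤ * X := by
  rw [Lam.idem_top_mul]
  change S.diagElt ⊤ X.topEntry * S.diagElt ⊤ 1 = _
  rw [← diagElt_mul, mul_one]

namespace IsAdmissible

theorem idem_ne_zero (hS : S.IsAdmissible) (i : P) : S.idem i ≠ 0 :=
  have := hS.nontrivial i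
  diagElt_ne_zero one_ne_zero

theorem exists_idem_mul_mul_eq (hS : S.IsAdmissible) (X : S.Lam) (hX : S.idem ⊤ * X ≠ 0) :
    ∃ Y, S.idem ⊤ * X * Y = S.idem ⊤ := by
  rw [Lam.idem_top_mul] at hX ⊢
  obtain ⟨v, hv⟩ := (hS.isUnit_of_ne_zero ⊤ X.topEntry fun h => hX (by rw [h, diagElt_zero])).exists_right_inv
  exact ⟨S.diagElt ⊤ v, by rw [← diagElt_mul, hv]; rfl⟩

/-- A nonzero entry of `X` at `(i, j)` can be multiplied into column `⊤` without vanishing; a single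
matrix unit does this, so no other entries interfere. -/
theorem exists_mul_ne_zero_of_ne_zero (hS : S.IsAdmissible) (X : S.Lam) (hX : X ≠ 0) :
    ∃ Y, X * Y * S.idem ⊤ ≠ 0 := by
  obtain ⟨i, j, hij, h⟩ := Lam.exists_entry_ne_zero hX
  obtain ⟨y, hy, hxy⟩ := hS.exists_mul_top_ne_zero hij _ (X.2.1 i j hij) h
  refine ⟨elt le_top ⟨y, hy⟩, fun h0 => hxy ?_⟩
  rw [mul_assoc, elt_mul_idem] at h0
  have := congrArg (fun Z : S.Lam => Z.1 i ⊤) h0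
  change (X.1 * Matrix.single j ⊤ y) i ⊤ = 0 at this
  rwa [Matrix.mul_single_apply_same] at this

end IsAdmissible

/-! ## The algebra `Λ̃` -/

/-- The element `y ↦ θ(y)` of `E`, for a functional `θ` on `Λ`. -/
def E.ofDual (θ : Module.Dual K S.Lam) : S.E :=
  show D K (leftIdeal (S.idem (⊤ : P))) from toDual (S.idem ⊤) θ 1

theorem E.ofDual_apply (θ : Module.Dual K S.Lam) (y : leftIdeal (S.idem (⊤ : P))) :
    E.ofDual θ y = θ y.1 := congrArg θ (one_mul y.1)

theorem E.exists_apply_ne_zero {f : S.E} (hf : f ≠ 0) : ∃ y, f y ≠ 0 := by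
  by_contra! h
  exact hf (E.ext h)

/-- The idempotent `e_m` as an element of `Λ e_m`. -/
def topGen (S : MultSystem K A P) : leftIdeal (S.idem (⊤ : P)) :=
  ⟨S.idem ⊤, Submodule.mem_span_singleton_self _⟩

theorem smul_topGen (y : leftIdeal (S.idem (⊤ : P))) : y.1 • S.topGen = y :=
  Subtype.ext (mem_leftIdeal_idem.1 y.2)

theorem idem_smul_diagElt_smul_topGen (r : S.Pt ⊤) :
    S.idem ⊤ • S.diagElt ⊤ r • S.topGen = S.diagElt ⊤ r • S.topGen := by
  rw [smul_smul]
  change (S.diagElt ⊤ 1 * S.diagElt ⊤ r) • S.topGen = _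
  rw [← diagElt_mul, one_mul]

theorem pt_smul_topGen (r : S.Pt ⊤) (f : S.E) :
    (r • f) S.topGen = f (S.diagElt ⊤ r • S.topGen) := by
  rw [E.pt_smul_apply]
  congr 1
  refine Subtype.ext ?_
  change S.diagElt ⊤ 1 * S.diagElt ⊤ r = S.diagElt ⊤ r * S.diagElt ⊤ 1
  rw [← diagElt_mul, ← diagElt_mul, one_mul, mul_one]

/-- This is faithfulness of the `R_m`-action on `E`, tested at `e_m`: take a functional not
vanishing on `e_{m,m} r`. -/
theorem exists_pt_smul_topGen_ne_zero {r : S.Pt ⊤} (hr : r ≠ 0) :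
    ∃ f : S.E, (r • f) S.topGen ≠ 0 := by
  obtain ⟨θ, hθ⟩ := Module.Projective.exists_dual_ne_zero K (diagElt_ne_zero hr)
  refine ⟨E.ofDual θ, ?_⟩
  rw [pt_smul_topGen, E.ofDual_apply]
  convert hθ using 2
  change S.diagElt ⊤ r * S.diagElt ⊤ 1 = _
  rw [← diagElt_mul, mul_one]

theorem finiteDimensional_lamTilde (hfin : ∀ (i j : P) (h : i ≤ j), FiniteDimensional K (S.R h)) :
    FiniteDimensional K S.LamTilde := by
  have := finiteDimensional_lam hfin
  have : FiniteDimensional K (leftIdeal (S.idem (⊤ : P))) :=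
    FiniteDimensional.finiteDimensional_submodule ((leftIdeal (S.idem (⊤ : P))).restrictScalars K)
  have : FiniteDimensional K S.E :=
    inferInstanceAs (FiniteDimensional K (leftIdeal (S.idem (⊤ : P)) →ₗ[K] K))
  have : FiniteDimensional K (S.Pt ⊤) := hfin ⊤ ⊤ le_rfl
  let L : S.LamTilde →ₗ[K] S.Pt ⊤ × S.E × S.Lam :=
    { toFun := fun u => (u.r, u.x, u.a)
      map_add' := fun _ _ => rfl
      map_smul' := fun _ _ => rfl }
  refine FiniteDimensional.of_injective L fun u v h => ?_
  exact TriMat.ext (congrArg Prod.fst h) (congrArg (fun p => p.2.1) h)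
    (congrArg (fun p => p.2.2) h)

theorem isIdempotentElem_tildeIdem (i : P) : IsIdempotentElem (S.tildeIdem i) := by
  refine TriMat.ext ?_ ?_ ?_
  · simp [tildeIdem]
  · simp [tildeIdem]
  · exact isIdempotentElem_idem i

theorem isIdempotentElem_tildeIdemZero : IsIdempotentElem S.tildeIdemZero := by
  refine TriMat.ext ?_ ?_ ?_ <;> simp [tildeIdemZero]

theorem tildeIdem_mul (i : P) (u : S.LamTilde) : S.tildeIdem i * u = ⟨0, 0, S.idem i * u.a⟩ := by
  refine TriMat.ext ?_ ?_ ?_ <;> simp [tildeIdem]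

theorem mul_tildeIdem (i : P) (u : S.LamTilde) :
    u * S.tildeIdem i = ⟨0, MulOpposite.op (S.idem i) • u.x, u.a * S.idem i⟩ := by
  refine TriMat.ext ?_ ?_ ?_ <;> simp [tildeIdem]

theorem tildeIdemZero_mul (u : S.LamTilde) : S.tildeIdemZero * u = ⟨u.r, u.x, 0⟩ := by
  refine TriMat.ext ?_ ?_ ?_ <;> simp [tildeIdemZero]

theorem mul_tildeIdemZero (u : S.LamTilde) : u * S.tildeIdemZero = ⟨u.r, 0, 0⟩ := by
  refine TriMat.ext ?_ ?_ ?_ <;> simp [tildeIdemZero]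

theorem tildeIdem_mul_mul_tildeIdem (u : S.LamTilde) :
    S.tildeIdem ⊤ * u * S.tildeIdem ⊤ = S.tildeIdem ⊤ * u := by
  rw [tildeIdem_mul, mul_tildeIdem, smul_zero, idem_top_mul_mul_idem_top]

theorem lamTilde_ne_zero {u : S.LamTilde} (hu : u ≠ 0) : u.r ≠ 0 ∨ u.x ≠ 0 ∨ u.a ≠ 0 := by
  by_contra! h
  exact hu (TriMat.ext h.1 h.2.1 h.2.2)

/-- The functional `(r, x, a) ↦ x(e_m)` on `Λ̃`. -/
def tildeFunctional (S : MultSystem K A P) : S.LamTilde →ₗ[K] K where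
  toFun u := u.x S.topGen
  map_add' _ _ := rfl
  map_smul' _ _ := rfl

theorem tildeFunctional_mul (u v : S.LamTilde) :
    S.tildeFunctional (u * v) = v.x (S.diagElt ⊤ u.r • S.topGen) + u.x (v.a • S.topGen) := by
  rw [← pt_smul_topGen]
  rfl

theorem tildeFunctional_mul_tildeIdem (u : S.LamTilde) :
    S.tildeFunctional (u * S.tildeIdem ⊤) = S.tildeFunctional u := by
  rw [mul_tildeIdem]
  exact congrArg u.x (smul_topGen S.topGen)

namespace IsAdmissible

theorem tildeIdem_ne_zero (hS : S.IsAdmissible) (i : P) : S.tildeIdem i ≠ 0 := fun h =>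
  hS.idem_ne_zero i (congrArg TriMat.a h)

theorem tildeIdemZero_ne_zero (hS : S.IsAdmissible) : S.tildeIdemZero ≠ 0 := fun h =>
  have := hS.nontrivial ⊤
  one_ne_zero (congrArg TriMat.r h)

theorem exists_tildeIdem_mul_mul_eq (hS : S.IsAdmissible) (u : S.LamTilde)
    (hu : S.tildeIdem ⊤ * u ≠ 0) : ∃ v, S.tildeIdem ⊤ * u * v = S.tildeIdem ⊤ := by
  rw [tildeIdem_mul] at hu ⊢
  obtain ⟨Y, hY⟩ := hS.exists_idem_mul_mul_eq u.a fun h => hu (by rw [h]; rfl)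
  refine ⟨⟨0, 0, Y⟩, TriMat.ext ?_ ?_ ?_⟩
  · simp [tildeIdem]
  · simp [tildeIdem]
  · exact hY

theorem exists_mul_mul_tildeIdemZero_eq (hS : S.IsAdmissible) (u : S.LamTilde)
    (hu : u * S.tildeIdemZero ≠ 0) : ∃ v, v * (u * S.tildeIdemZero) = S.tildeIdemZero := by
  rw [mul_tildeIdemZero] at hu ⊢
  obtain ⟨v, hv⟩ := (hS.isUnit_of_ne_zero ⊤ u.r fun h => hu (by rw [h]; rfl)).exists_left_inv
  refine ⟨⟨v, 0, 0⟩, TriMat.ext ?_ ?_ ?_⟩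
  · exact hv
  · simp [tildeIdemZero]
  · simp [tildeIdemZero]

theorem exists_mul_mul_tildeIdem_ne_zero (hS : S.IsAdmissible) (u : S.LamTilde) (hu : u ≠ 0) :
    ∃ v, u * v * S.tildeIdem ⊤ ≠ 0 := by
  -- The functional is unchanged under right multiplication by `e_m`, so a nonzero value on `u v`
  -- already shows `u v e_m ≠ 0`.
  suffices u.a ≠ 0 ∨ ∃ v, S.tildeFunctional (u * v) ≠ 0 by
    obtain h | ⟨v, hv⟩ := this
    · obtain ⟨Y, hY⟩ := hS.exists_mul_ne_zero_of_ne_zero u.a h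
      exact ⟨⟨0, 0, Y⟩, fun h0 => hY (congrArg TriMat.a h0)⟩
    · exact ⟨v, fun h0 => hv (by rw [← tildeFunctional_mul_tildeIdem, h0, map_zero])⟩
  rcases lamTilde_ne_zero hu with h | h | h
  · obtain ⟨f, hf⟩ := exists_pt_smul_topGen_ne_zero h
    refine .inr ⟨⟨0, f, 0⟩, ?_⟩
    rwa [tildeFunctional_mul, zero_smul, map_zero, add_zero, ← pt_smul_topGen]
  · obtain ⟨y, hy⟩ := E.exists_apply_ne_zero h
    refine .inr ⟨⟨0, 0, y.1⟩, ?_⟩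
    rwa [tildeFunctional_mul, smul_topGen, E.zero_apply, zero_add]
  · exact .inl h

theorem exists_tildeIdemZero_mul_mul_ne_zero (hS : S.IsAdmissible) (u : S.LamTilde) (hu : u ≠ 0) :
    ∃ v, S.tildeIdemZero * (v * u) ≠ 0 := by
  simp only [tildeIdemZero_mul]
  by_cases h : u.a = 0
  -- If the `Λ`-entry vanishes, then `u = e_0 u`.
  · refine ⟨1, fun h0 => hu ?_⟩
    rw [one_mul u] at h0
    have hr := congrArg TriMat.r h0
    have hx := congrArg TriMat.x h0
    exact TriMat.ext hr hx h
  · obtain ⟨Y, hY⟩ := hS.exists_mul_ne_zero_of_ne_zero u.a h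
    -- The `E`-entry of `e_0 v u`, for `v` carrying `θ` restricted to `Λ e_m`, is `θ·a`, which is
    -- nonzero at `Y e_m`.
    obtain ⟨θ, hθ⟩ := Module.Projective.exists_dual_ne_zero K hY
    refine ⟨⟨0, E.ofDual θ, 0⟩, fun h0 => hθ ?_⟩
    have := DFunLike.congr_fun (congrArg TriMat.x h0)
      ⟨Y * S.idem ⊤, Submodule.mem_span_singleton.2 ⟨Y, rfl⟩⟩
    change ((0 : S.Pt ⊤) • u.x + MulOpposite.op u.a • E.ofDual θ) _ = 0 at this
    rw [zero_smul, zero_add, E.op_smul_apply, E.ofDual_apply] at this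
    rw [mul_assoc]
    exact this

end IsAdmissible

theorem exists_tildeFunctional_left {u : S.LamTilde} (hu : u ∈ rightIdeal S.tildeIdemZero)
    (hne : u ≠ 0) : ∃ v ∈ leftIdeal (S.tildeIdem ⊤), S.tildeFunctional (u * v) ≠ 0 := by
  rw [mem_rightIdeal_iff isIdempotentElem_tildeIdemZero, tildeIdemZero_mul] at hu
  have ha : u.a = 0 := (congrArg TriMat.a hu).symm
  by_cases hx : u.x = 0
  · have hr : u.r ≠ 0 := fun h => hne (TriMat.ext h hx ha)
    obtain ⟨f, hf⟩ := exists_pt_smul_topGen_ne_zero hr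
    -- Replacing `f` by `f e_m` puts the witness in `Λ̃ e_m` and keeps its value on elements fixed
    -- by left multiplication by `e_m`.
    refine ⟨⟨0, MulOpposite.op (S.idem ⊤) • f, 0⟩, ?_, ?_⟩
    · rw [mem_leftIdeal_iff (isIdempotentElem_tildeIdem ⊤), mul_tildeIdem]
      refine TriMat.ext rfl ?_ (zero_mul _)
      change MulOpposite.op (S.idem ⊤) • MulOpposite.op (S.idem ⊤) • f = _
      rw [smul_smul, ← MulOpposite.op_mul, isIdempotentElem_idem]
    · rw [tildeFunctional_mul, hx, E.zero_apply, add_zero, E.op_smul_apply]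
      change f (S.idem ⊤ • _) ≠ 0
      rwa [idem_smul_diagElt_smul_topGen, ← pt_smul_topGen]
  · obtain ⟨y, hy⟩ := E.exists_apply_ne_zero hx
    refine ⟨⟨0, 0, y.1⟩, ?_, ?_⟩
    · rw [mem_leftIdeal_iff (isIdempotentElem_tildeIdem ⊤), mul_tildeIdem]
      exact TriMat.ext rfl (smul_zero _) (mem_leftIdeal_idem.1 y.2)
    · rw [tildeFunctional_mul, smul_topGen, E.zero_apply, zero_add]
      exact hy

theorem exists_tildeFunctional_right {v : S.LamTilde} (hv : v ∈ leftIdeal (S.tildeIdem ⊤))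
    (hne : v ≠ 0) : ∃ u ∈ rightIdeal S.tildeIdemZero, S.tildeFunctional (u * v) ≠ 0 := by
  rw [mem_leftIdeal_iff (isIdempotentElem_tildeIdem ⊤), mul_tildeIdem] at hv
  have hr : v.r = 0 := (congrArg TriMat.r hv).symm
  have hxe : MulOpposite.op (S.idem ⊤) • v.x = v.x := congrArg TriMat.x hv
  have hae : v.a * S.idem ⊤ = v.a := congrArg TriMat.a hv
  by_cases hx : v.x = 0
  · have ha : v.a ≠ 0 := fun h => hne (TriMat.ext hr hx h)
    obtain ⟨θ, hθ⟩ := Module.Projective.exists_dual_ne_zero K ha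
    refine ⟨⟨0, E.ofDual θ, 0⟩, ?_, ?_⟩
    · rw [mem_rightIdeal_iff isIdempotentElem_tildeIdemZero, tildeIdemZero_mul]
    · rw [tildeFunctional_mul, hx, E.zero_apply, zero_add, E.ofDual_apply]
      change θ (v.a * S.idem ⊤) ≠ 0
      rwa [hae]
  · obtain ⟨y, hy⟩ := E.exists_apply_ne_zero hx
    refine ⟨⟨y.1.topEntry, 0, 0⟩, ?_, ?_⟩
    · rw [mem_rightIdeal_iff isIdempotentElem_tildeIdemZero, tildeIdemZero_mul]
    · rw [tildeFunctional_mul, E.zero_apply, add_zero, ← Lam.idem_top_mul, mul_smul, smul_topGen]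
      rw [← hxe] at hy
      exact hy

/-- The isomorphism `e_0 Λ̃ ≅ D(Λ̃ e_m)`. -/
def tildeDualEquiv (hfin : ∀ (i j : P) (h : i ≤ j), FiniteDimensional K (S.R h)) :
    rightIdeal S.tildeIdemZero ≃ₗ[S.LamTildeᵐᵒᵖ] D K (leftIdeal (S.tildeIdem ⊤)) :=
  have := finiteDimensional_lamTilde hfin
  LinearEquiv.ofBijective _ <| toDual_bijective S.tildeFunctional
    (fun _ hu hne => exists_tildeFunctional_left hu hne)
    (fun _ hv hne => exists_tildeFunctional_right hv hne)

/-! ## Posets with a least element -/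

/-- The functional `X ↦ F(X_{i,j})` on `Λ(R)`. -/
def entryFunctional (S : MultSystem K A P) (F : A →ₗ[K] K) (i j : P) : S.Lam →ₗ[K] K where
  toFun X := F (X.1 i j)
  map_add' X Y := map_add F (X.1 i j) (Y.1 i j)
  map_smul' c X := map_smul F c (X.1 i j)

/-- The form `F((XY)_{z,⊤})` on `e_z Λ × Λ e_⊤` splits into the pairings `R_{z,i} × R_{i,⊤} → K`, so
nondegeneracy is checked one entry at a time against a matrix unit. -/
theorem exists_dualEquiv_of_least (hS : S.IsAdmissible)
    (hfin : ∀ (i j : P) (h : i ≤ j), FiniteDimensional K (S.R h)) {z : P} (hz : ∀ i, z ≤ i)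
    (hd : ∀ i, Module.finrank K (S.R (hz i)) = Module.finrank K (S.R (le_top : i ≤ ⊤))) :
    Nonempty (rightIdeal (S.idem z) ≃ₗ[S.Lamᵐᵒᵖ] D K (leftIdeal (S.idem (⊤ : P)))) := by
  have := finiteDimensional_lam hfin
  obtain ⟨F, hF⟩ := exists_pairing hS hfin hz (hd ⊤)
  refine ⟨LinearEquiv.ofBijective _ (toDual_bijective (S.entryFunctional F z ⊤)
    (fun X hX hne => ?_) (fun Y hY hne => ?_))⟩
  · rw [mem_rightIdeal_iff (isIdempotentElem_idem z)] at hX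
    obtain ⟨i, j, hij, h⟩ := Lam.exists_entry_ne_zero hne
    obtain rfl : i = z := by
      by_contra hi
      exact h (by rw [← hX]; exact val_idem_mul_of_ne z X hi j)
    obtain ⟨y, hy, hxy⟩ := hF j _ (X.2.1 i j hij) h
    refine ⟨elt le_top ⟨y, hy⟩, mem_leftIdeal_idem.2 (elt_mul_idem _ _), ?_⟩
    change F ((X.1 * Matrix.single j ⊤ y : Matrix P P A) i ⊤) ≠ 0
    rwa [Matrix.mul_single_apply_same]
  · rw [mem_leftIdeal_idem] at hY
    obtain ⟨i, j, hij, h⟩ := Lam.exists_entry_ne_zero hne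
    obtain rfl : j = ⊤ := by
      by_contra hj
      exact h (by rw [← hY]; exact val_mul_idem_of_ne ⊤ Y hj i)
    obtain ⟨x, hx, hxy⟩ := exists_pairing_right hfin hz (hd i) (hF i) (Y.2.1 i ⊤ hij) h
    refine ⟨elt (hz i) ⟨x, hx⟩, (mem_rightIdeal_iff (isIdempotentElem_idem z)).2
      (idem_mul_elt _ _), ?_⟩
    change F ((Matrix.single z i x * Y.1 : Matrix P P A) z ⊤) ≠ 0
    rwa [Matrix.single_mul_apply_same]

end MultSystem

end PeakAlg

end

theorem mainTheorem6 {K A P : Type*} [Field K] [Ring A] [Algebra K A]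
    [PartialOrder P] [OrderTop P] [Fintype P] [DecidableEq P]
    (S : PeakAlg.MultSystem K A P) (hS : S.IsAdmissible)
    (hfin : ∀ (i j : P) (h : i ≤ j), FiniteDimensional K (S.R h)) :
    -- the triangular matrix algebra built from `E`, the injective envelope of `e_m Λ`
    (PeakAlg.IsInjectiveEnvelope S.Lamᵐᵒᵖ (PeakAlg.rightIdeal (S.idem ⊤)) S.E ∧
      PeakAlg.IsRightPeak S.LamTilde ∧
      PeakAlg.IsLeftPeak S.LamTilde ∧
      Nonempty (PeakAlg.D K (PeakAlg.leftIdeal (S.tildeIdem ⊤)) ≃ₗ[S.LamTildeᵐᵒᵖ]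
        PeakAlg.rightIdeal S.tildeIdemZero) ∧
      Module.Projective S.LamTildeᵐᵒᵖ (PeakAlg.rightIdeal S.tildeIdemZero) ∧
      PeakAlg.IsOneGorenstein S.LamTilde) ∧
    -- posets which also have a least element `z`
    (∀ (z : P) (hz : ∀ i : P, z ≤ i),
      S.R (le_refl z) = S.R (le_refl (⊤ : P)) →
      (∀ i : P, Nonempty (S.R (hz i) ≃ₗ[K] Module.Dual K (S.R (le_top : i ≤ ⊤)))) →
      PeakAlg.IsOneGorenstein S.Lam) := by
  open PeakAlg MultSystem in
  have := finiteDimensional_lam hfin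
  have := finiteDimensional_lamTilde hfin
  refine ⟨⟨isInjectiveEnvelope_dual (isIdempotentElem_idem ⊤) (hS.idem_ne_zero ⊤)
      idem_top_mul_mul_idem_top hS.exists_idem_mul_mul_eq,
    isRightPeak_of_idem K (isIdempotentElem_tildeIdem ⊤) (hS.tildeIdem_ne_zero ⊤)
      hS.exists_tildeIdem_mul_mul_eq hS.exists_mul_mul_tildeIdem_ne_zero,
    isLeftPeak_of_idem K isIdempotentElem_tildeIdemZero hS.tildeIdemZero_ne_zero
      hS.exists_mul_mul_tildeIdemZero_eq hS.exists_tildeIdemZero_mul_mul_ne_zero,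
    ⟨(tildeDualEquiv hfin).symm⟩,
    projective_rightIdeal isIdempotentElem_tildeIdemZero,
    isOneGorenstein_of_idem (isIdempotentElem_tildeIdem ⊤) (hS.tildeIdem_ne_zero ⊤)
      tildeIdem_mul_mul_tildeIdem hS.exists_tildeIdem_mul_mul_eq
      hS.exists_mul_mul_tildeIdem_ne_zero isIdempotentElem_tildeIdemZero (tildeDualEquiv hfin)⟩,
    fun z hz _ hdual => ?_⟩
  -- Only dimensions are extracted from the given isomorphisms; the pairing itself comes from
  -- multiplication.
  obtain ⟨φ⟩ := exists_dualEquiv_of_least hS hfin hz fun i =>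
    (hdual i).some.finrank_eq.trans Subspace.dual_finrank_eq
  exact isOneGorenstein_of_idem (isIdempotentElem_idem ⊤) (hS.idem_ne_zero ⊤)
    idem_top_mul_mul_idem_top hS.exists_idem_mul_mul_eq hS.exists_mul_ne_zero_of_ne_zero
    (isIdempotentElem_idem z) φ
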